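/- Let $B$ and $Y$ be Banach spaces, both linear subspaces of a common vector space (no continuous embedding between them is assumed), and let $T>0$. Let $M_+$ be a seminormed nonnegative cone in $B$, that is, $M_+\subset B$, $cu\in M_+$ for all $u\in M_+$ and $c\ge 0$, and there is a function $[\cdot]:M_+\to[0,\infty)$ such that $[u]=0$ if and only if $u=0$, and $[cu]=c[u]$ for all $u\in M_+$ and $c\ge 0$. Let either $1\le p<\infty$ and $r=1$, or $p=\infty$ and $1<r\le\infty$. Assume: (i) $M_+\hookrightarrow B$ compactly: every sequence $(u_n)\subset M_+$ for which $([u_n])$ is bounded has a subsequence converging in $B$. (ii) If $(w_n)\subset B\cap Y$, $w_n\to w$ in $B$ and $w_n\to 0$ in $Y$ as $n\to\infty$, then $w=0$. (iii) $U\subset L^p(0,T;M_+\cap Y)$ is bounded in $L^p(0,T;M_+)$. That is, every $u\in U$ belongs to $L^p(0,T;B)$ and to $L^p(0,T;Y)$, $u(t)\in M_+$ for almost every $t\in(0,T)$, the function $t\mapsto[u(t)]$ belongs to $L^p(0,T)$, and $\sup_{u\in U}\|[u(\cdot)]\|_{L^p(0,T)}<\infty$. (iv) $\partial U/\partial t$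 is bounded in $L^r(0,T;Y)$: every $u\in U$ has a distributional time derivative $\partial u/\partial t\in L^r(0,T;Y)$, and $\sup_{u\in U}\|\partial u/\partial t\|_{L^r(0,T;Y)}<\infty$. Then $U$ is relatively compact in $L^p(0,T;B)$. If $p=\infty$, then moreover every $u\in U$ has a representative in $C([0,T];B)$, and the set of these representatives is relatively compact in $C([0,T];B)$. -/

import Mathlib

open MeasureTheory Set Filter Topology
open scoped ENNReal NNReal ContDiff

noncomputable section

namespace AubinLions

/-- Lebesgue measure on the time interval `(0, T)`. -/
abbrev timeMeasure (T : ℝ) : Measure ℝ := volume.restrict (Ioo 0 T)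

/-- A seminormed nonnegative cone in `B`: a subset stable under multiplication by nonnegative
reals, with a nonnegative, positively homogeneous and definite function `gauge` on it (no triangle
inequality, no convexity).  The values of `gauge` off `carrier` play no role. -/
structure SeminormedCone (B : Type*) [NormedAddCommGroup B] [NormedSpace ℝ B] where
  carrier : Set B
  smul_mem : ∀ u ∈ carrier, ∀ c : ℝ, 0 ≤ c → c • u ∈ carrier
  gauge : B → ℝ
  gauge_nonneg : ∀ u ∈ carrier, 0 ≤ gauge u
  gauge_eq_zero_iff : ∀ u ∈ carrier, (gauge u = 0 ↔ u = 0)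
  gauge_smul : ∀ u ∈ carrier, ∀ c : ℝ, 0 ≤ c → gauge (c • u) = c * gauge u

section Cone

variable {B : Type*} [NormedAddCommGroup B] [NormedSpace ℝ B]

/-- `M ↪ B` compactly: every bounded sequence in `M` has a subsequence converging in `B`. -/
def SeminormedCone.CompactlyEmbedded (M : SeminormedCone B) : Prop :=
  ∀ u : ℕ → B, (∀ n, u n ∈ M.carrier) → (∃ C : ℝ, ∀ n, M.gauge (u n) ≤ C) →
    ∃ φ : ℕ → ℕ, StrictMono φ ∧ ∃ b : B, Tendsto (fun n => u (φ n)) atTop (𝓝 b)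

/-- `u ∈ L^p(0,T;M)`: the function `u ∈ L^p(0,T;B)` has values in `M` almost everywhere, and
`t ↦ [u(t)]` belongs to `L^p(0,T)`. -/
def SeminormedCone.MemLpCone (M : SeminormedCone B) {p : ℝ≥0∞} {T : ℝ}
    (u : Lp B p (timeMeasure T)) : Prop :=
  (∀ᵐ t ∂timeMeasure T, u t ∈ M.carrier) ∧ MemLp (fun t => M.gauge (u t)) p (timeMeasure T)

/-- `U` is a bounded subset of `L^p(0,T;M)`. -/
def SeminormedCone.BoundedInLpCone (M : SeminormedCone B) {p : ℝ≥0∞} {T : ℝ}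
    (U : Set (Lp B p (timeMeasure T))) : Prop :=
  ∃ C : ℝ≥0, ∀ u ∈ U,
    M.MemLpCone u ∧ eLpNorm (fun t => M.gauge (u t)) p (timeMeasure T) ≤ C

end Cone

section Couple

/-! `B` and `Y` are linear subspaces of a common vector space `E`, through the injective linear maps
`ιB` and `ιY`; thus `b : B` and `y : Y` are the same vector when `ιB b = ιY y`. -/

variable {B Y E : Type*} [NormedAddCommGroup B] [NormedSpace ℝ B]
  [NormedAddCommGroup Y] [NormedSpace ℝ Y] [AddCommGroup E] [Module ℝ E]

/-- If `w_n → w` in `B` and `w_n → 0` in `Y`, then `w = 0`. -/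
def LimitCompatible (ιB : B →ₗ[ℝ] E) (ιY : Y →ₗ[ℝ] E) : Prop :=
  ∀ (b : ℕ → B) (y : ℕ → Y) (w : B), (∀ n, ιB (b n) = ιY (y n)) →
    Tendsto b atTop (𝓝 w) → Tendsto y atTop (𝓝 0) → w = 0

/-- The `B`-valued function `u` and the `Y`-valued function `v` on `(0, T)` are the same function
almost everywhere. -/
def SameFunction (ιB : B →ₗ[ℝ] E) (ιY : Y →ₗ[ℝ] E) {p q : ℝ≥0∞} {T : ℝ}
    (u : Lp B p (timeMeasure T)) (v : Lp Y q (timeMeasure T)) : Prop :=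
  ∀ᵐ t ∂timeMeasure T, ιB (u t) = ιY (v t)

/-- `v'` is the derivative of `v` in the sense of `Y`-valued distributions on `(0, T)`. -/
def HasWeakTimeDeriv {q r : ℝ≥0∞} {T : ℝ}
    (v : Lp Y q (timeMeasure T)) (v' : Lp Y r (timeMeasure T)) : Prop :=
  ∀ φ : ℝ → ℝ, ContDiff ℝ ∞ φ → HasCompactSupport φ → tsupport φ ⊆ Ioo 0 T →
    ∫ t in Ioo 0 T, deriv φ t • v t = -∫ t in Ioo 0 T, φ t • v' t

/-- `∂U/∂t` is bounded in `L^r(0,T;Y)`. -/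
def BoundedTimeDeriv (ιB : B →ₗ[ℝ] E) (ιY : Y →ₗ[ℝ] E) {p : ℝ≥0∞} {T : ℝ}
    (U : Set (Lp B p (timeMeasure T))) (r : ℝ≥0∞) : Prop :=
  ∃ C : ℝ, ∀ u ∈ U, ∃ v : Lp Y p (timeMeasure T), SameFunction ιB ιY u v ∧
    ∃ v' : Lp Y r (timeMeasure T), HasWeakTimeDeriv v v' ∧ ‖v'‖ ≤ C

end Couple

section Continuous

variable {B : Type*} [NormedAddCommGroup B]

/-- `f ∈ C([0,T];B)` is a representative of the class `u`. -/
def IsContinuousRep {p : ℝ≥0∞} {T : ℝ} (u : Lp B p (timeMeasure T)) (f : C(Icc (0 : ℝ) T, B)) :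
    Prop :=
  ∀ᵐ t ∂timeMeasure T, ∀ ht : t ∈ Icc (0 : ℝ) T, f ⟨t, ht⟩ = u t

/-- `U` is a relatively compact subset of `C([0,T];B)`: each of its elements has a continuous
representative, and the set of these representatives has compact closure for uniform
convergence. -/
def RelativelyCompactInC {p : ℝ≥0∞} {T : ℝ} (U : Set (Lp B p (timeMeasure T))) : Prop :=
  (∀ u ∈ U, ∃ f : C(Icc (0 : ℝ) T, B), IsContinuousRep u f) ∧
    IsCompact (closure {f : C(Icc (0 : ℝ) T, B) | ∃ u ∈ U, IsContinuousRep u f})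

end Continuous

end AubinLions

end

/-! Two estimates carry the proof. `CompactlyEmbedded.norm_sub_le` is an Ehrling inequality: the
`B`-norm of a difference of two cone elements is at most a small multiple of their gauges plus a
large multiple of the `Y`-norm. Since a difference need not lie in the cone, it is stated for pairs.
`exists_ae_enorm_sub_le_of_weakDeriv` bounds increments in `Y` by the integral of the norm of the
weak derivative, outside a null set. Together they control increments of `u` in `B`.

If `p < ∞`, cut `(0, T)` into cells of length `h` and sample `u` in each cell at a point where the
`p`-th power of the gauge is at most its mean. The step function of the samples is within `2εK + C D
h^(1/p)` of `u` in `L^p`, where `K` and `D` bound the gauges and the derivatives. The samples have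
gauge bounded independently of `u`, so the step functions lie in the continuous image of a finite
product of compact sets. Hence `U` is totally bounded.

If `p = ∞`, the factor `h^(1/p)` does not decay. Instead `r > 1` and Hölder's inequality make the
integral of the derivative over short intervals uniformly small. This gives a common modulus of
continuity, and Arzelà–Ascoli applies; compactness in `L^∞` follows by continuity of the map from
`C([0,T];B)`. -/

namespace AubinLions

open Convolution ContinuousLinearMap

/-! ### Weak derivatives and increments in `Y` -/

/-- The primitive of a normalised bump function. -/
noncomputable def bumpPrimitive (f : ContDiffBump (0 : ℝ)) (x : ℝ) : ℝ :=
  ∫ y in (-f.rOut)..x, f.normed volume y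

section BumpPrimitive

variable (f : ContDiffBump (0 : ℝ))

lemma hasDerivAt_bumpPrimitive (x : ℝ) :
    HasDerivAt (bumpPrimitive f) (f.normed volume x) x :=
  f.continuous_normed.integral_hasStrictDerivAt _ x |>.hasDerivAt

lemma contDiff_bumpPrimitive : ContDiff ℝ ∞ (bumpPrimitive f) := by
  rw [contDiff_infty_iff_deriv]
  refine ⟨fun x => (hasDerivAt_bumpPrimitive f x).differentiableAt, ?_⟩
  rw [funext fun x => (hasDerivAt_bumpPrimitive f x).deriv]
  exact f.contDiff_normed

lemma normed_eq_zero {x : ℝ} (hx : f.rOut ≤ |x|) : f.normed volume x = 0 := by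
  rw [← Function.notMem_support, f.support_normed_eq]
  simpa using hx

lemma bumpPrimitive_eq_zero {x : ℝ} (hx : x ≤ -f.rOut) : bumpPrimitive f x = 0 := by
  refine intervalIntegral.integral_zero_ae (Eventually.of_forall fun y hy => ?_)
  rw [uIoc_of_ge hx] at hy
  have := f.rOut_pos
  exact normed_eq_zero f (by rw [abs_of_nonpos (by linarith [hy.2])]; linarith [hy.2])

lemma bumpPrimitive_eq_one {x : ℝ} (hx : f.rOut ≤ x) : bumpPrimitive f x = 1 := by
  rw [bumpPrimitive, intervalIntegral.integral_eq_integral_of_support_subset, f.integral_normed]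
  rw [f.support_normed_eq, Real.ball_eq_Ioo]
  intro y hy
  exact ⟨by linarith [hy.1], by linarith [hy.2]⟩

lemma monotone_bumpPrimitive : Monotone (bumpPrimitive f) :=
  monotone_of_deriv_nonneg (fun x => (hasDerivAt_bumpPrimitive f x).differentiableAt) fun x => by
    rw [(hasDerivAt_bumpPrimitive f x).deriv]
    exact f.nonneg_normed x

lemma bumpPrimitive_nonneg (x : ℝ) : 0 ≤ bumpPrimitive f x := by
  rw [← bumpPrimitive_eq_zero f (min_le_right x (-f.rOut))]
  exact monotone_bumpPrimitive f (min_le_left _ _)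

lemma bumpPrimitive_le_one (x : ℝ) : bumpPrimitive f x ≤ 1 := by
  rw [← bumpPrimitive_eq_one f (le_max_right x f.rOut)]
  exact monotone_bumpPrimitive f (le_max_left _ _)

end BumpPrimitive

variable {Y : Type*} [NormedAddCommGroup Y] [NormedSpace ℝ Y]

/-- Testing a weak derivative against a mollified indicator of `[s, t]`. -/
lemma norm_convolution_sub_le {T : ℝ} {v v' : ℝ → Y}
    (hv : Integrable v (timeMeasure T)) (hv' : Integrable v' (timeMeasure T))
    (h : ∀ φ : ℝ → ℝ, ContDiff ℝ ∞ φ → HasCompactSupport φ → tsupport φ ⊆ Ioo 0 T →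
      ∫ t in Ioo 0 T, deriv φ t • v t = -∫ t in Ioo 0 T, φ t • v' t)
    (f : ContDiffBump (0 : ℝ)) {s t : ℝ} (hst : s ≤ t) (hs : 0 < s - f.rOut)
    (ht : t + f.rOut < T) :
    ‖(f.normed volume ⋆[lsmul ℝ ℝ, volume] (Ioo 0 T).indicator v) t
      - (f.normed volume ⋆[lsmul ℝ ℝ, volume] (Ioo 0 T).indicator v) s‖
      ≤ ∫ x in (s - f.rOut)..(t + f.rOut), ‖v' x‖ ∂timeMeasure T := by
  have hpos := f.rOut_pos
  -- The derivative of this test function is the kernel centred at `s` minus the kernel centred at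
  -- `t`, so testing `v` against it produces the difference of two mollified values.
  set φ : ℝ → ℝ := fun x => bumpPrimitive f (x - s) - bumpPrimitive f (x - t) with hφ
  have hconv : ∀ a, (f.normed volume ⋆[lsmul ℝ ℝ, volume] (Ioo 0 T).indicator v) a
      = ∫ x in Ioo 0 T, f.normed volume (x - a) • v x := fun a => by
    rw [convolution_lsmul_swap, ← integral_indicator measurableSet_Ioo]
    congr 1
    ext x
    rw [← neg_sub x a, f.normed_neg]
    by_cases hx : x ∈ Ioo 0 T <;> simp [hx]
  have hint : ∀ a, Integrable (fun x => f.normed volume (x - a) • v x) (timeMeasure T) := fun a => by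
    obtain ⟨C, hC⟩ := (f.hasCompactSupport_normed (μ := volume)).exists_bound_of_continuous
      f.continuous_normed
    exact hv.bdd_smul C ((f.continuous_normed.comp (by fun_prop)).aestronglyMeasurable)
      (Eventually.of_forall fun x => hC _)
  have hderiv : ∀ x, deriv φ x = f.normed volume (x - s) - f.normed volume (x - t) := fun x =>
    (((hasDerivAt_bumpPrimitive f (x - s)).comp_sub_const x s).sub
      ((hasDerivAt_bumpPrimitive f (x - t)).comp_sub_const x t)).deriv
  have hzero : ∀ x, x ∉ Icc (s - f.rOut) (t + f.rOut) → φ x = 0 := fun x hx => by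
    rw [mem_Icc, not_and_or, not_le, not_le] at hx
    rcases hx with hx | hx
    · simp only [hφ]
      rw [bumpPrimitive_eq_zero f (by linarith), bumpPrimitive_eq_zero f (by linarith), sub_zero]
    · simp only [hφ]
      rw [bumpPrimitive_eq_one f (by linarith), bumpPrimitive_eq_one f (by linarith), sub_self]
  have hsupp : tsupport φ ⊆ Icc (s - f.rOut) (t + f.rOut) :=
    closure_minimal (fun x hx => by_contra fun hx' => hx (hzero x hx')) isClosed_Icc
  have hle : ∀ x, |φ x| ≤ 1 := fun x => abs_sub_le_of_nonneg_of_le (bumpPrimitive_nonneg f _)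
    (bumpPrimitive_le_one f _) (bumpPrimitive_nonneg f _) (bumpPrimitive_le_one f _)
  have key := h φ
    (((contDiff_bumpPrimitive f).comp (contDiff_id.sub contDiff_const)).sub
      ((contDiff_bumpPrimitive f).comp (contDiff_id.sub contDiff_const)))
    (HasCompactSupport.of_support_subset_isCompact isCompact_Icc
      ((subset_tsupport _).trans hsupp))
    (hsupp.trans fun x hx => ⟨by linarith [hx.1], by linarith [hx.2]⟩)
  simp only [hderiv, sub_smul] at key
  rw [integral_sub (hint s) (hint t)] at key
  rw [hconv, hconv, norm_sub_rev, key, norm_neg,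
    intervalIntegral.integral_of_le (by linarith), ← integral_Icc_eq_integral_Ioc,
    ← integral_indicator measurableSet_Icc]
  refine norm_integral_le_of_norm_le (hv'.norm.indicator measurableSet_Icc)
    (Eventually.of_forall fun x => ?_)
  by_cases hx : x ∈ Icc (s - f.rOut) (t + f.rOut)
  · rw [indicator_of_mem hx, norm_smul]
    exact mul_le_of_le_one_left (norm_nonneg _) (hle x)
  · simp [indicator_of_notMem hx, hzero x hx]

/-- A function with an integrable weak derivative is, up to a null set, estimated by the integral
of the norm of that derivative. -/
lemma exists_ae_enorm_sub_le_of_weakDeriv [CompleteSpace Y] {T : ℝ} {v v' : ℝ → Y}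
    (hv : Integrable v (timeMeasure T)) (hv' : Integrable v' (timeMeasure T))
    (h : ∀ φ : ℝ → ℝ, ContDiff ℝ ∞ φ → HasCompactSupport φ → tsupport φ ⊆ Ioo 0 T →
      ∫ t in Ioo 0 T, deriv φ t • v t = -∫ t in Ioo 0 T, φ t • v' t) :
    ∃ G : Set ℝ, (∀ᵐ t ∂timeMeasure T, t ∈ G) ∧ ∀ s ∈ G, ∀ t ∈ G, s ≤ t →
      ‖v t - v s‖ₑ ≤ ∫⁻ x in Icc s t, ‖v' x‖ₑ ∂timeMeasure T := by
  -- The fixed ratio 2 of outer to inner radius is what the almost everywhere convergence of the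
  -- mollifications requires.
  let f : ℕ → ContDiffBump (0 : ℝ) := fun n =>
    ⟨1 / ((n : ℝ) + 1) / 2, 1 / ((n : ℝ) + 1), by positivity, half_lt_self (by positivity)⟩
  have hf : Tendsto (fun n => (f n).rOut) atTop (𝓝 0) := tendsto_one_div_add_atTop_nhds_zero_nat
  set w := (Ioo 0 T).indicator v with hw
  have hwint : Integrable w := (integrable_indicator_iff measurableSet_Ioo).2 hv
  have hae := ContDiffBump.ae_convolution_tendsto_right_of_locallyIntegrable (φ := f) (l := atTop)
    (K := 2) (μ := volume) hf
    (Eventually.of_forall fun n => by simp only [f]; linarith) hwint.locallyIntegrable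
  refine ⟨{x | x ∈ Ioo 0 T ∧ Tendsto (fun i => ((f i).normed volume ⋆[lsmul ℝ ℝ, volume] w) x)
    atTop (𝓝 (w x))}, ?_, ?_⟩
  · filter_upwards [ae_restrict_mem measurableSet_Ioo, ae_restrict_of_ae hae] with x hx hx'
    exact ⟨hx, hx'⟩
  rintro s ⟨hs, hs'⟩ t ⟨ht, ht'⟩ hst
  have hii : ∀ a b, IntervalIntegrable (fun x => ‖v' x‖) (timeMeasure T) a b :=
    fun a b => hv'.norm.intervalIntegrable
  -- Lebesgue measure has no atoms, so the enlargement of `[s, t]` by the mollification radius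
  -- disappears in the limit.
  have hcont := intervalIntegral.continuous_primitive hii 0
  have hlim : Tendsto (fun n => ∫ x in (s - (f n).rOut)..(t + (f n).rOut), ‖v' x‖ ∂timeMeasure T)
      atTop (𝓝 (∫ x in s..t, ‖v' x‖ ∂timeMeasure T)) := by
    have h1 := ((hcont.tendsto t).comp (by simpa using (tendsto_const_nhds (x := t)).add hf)).sub
      ((hcont.tendsto s).comp (by simpa using (tendsto_const_nhds (x := s)).sub hf))
    rw [intervalIntegral.integral_interval_sub_left (hii _ _) (hii _ _)] at h1
    refine h1.congr fun n => ?_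
    exact intervalIntegral.integral_interval_sub_left (hii _ _) (hii _ _)
  have hle : ‖v t - v s‖ ≤ ∫ x in s..t, ‖v' x‖ ∂timeMeasure T := by
    have h2 := (ht'.sub hs').norm
    rw [hw, indicator_of_mem hs, indicator_of_mem ht, ← hw] at h2
    refine le_of_tendsto_of_tendsto h2 hlim ?_
    filter_upwards [hf.eventually_lt_const (sub_pos.2 hs.1),
      hf.eventually_lt_const (sub_pos.2 ht.2)] with n h3 h4
    exact norm_convolution_sub_le hv hv' h (f n) hst (by linarith) (by linarith)
  rw [intervalIntegral.integral_of_le hst, ← integral_Icc_eq_integral_Ioc] at hle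
  rw [← ofReal_norm]
  refine (ENNReal.ofReal_le_ofReal hle).trans_eq ?_
  rw [ofReal_integral_eq_lintegral_ofReal hv'.norm.integrableOn
    (Eventually.of_forall fun x => norm_nonneg _)]
  simp only [ofReal_norm]

variable {B E : Type*} [NormedAddCommGroup B] [NormedSpace ℝ B] [AddCommGroup E] [Module ℝ E]

/-! ### Compactness in the cone and Ehrling's inequality -/

namespace SeminormedCone

variable {M : SeminormedCone B}

/-- Bounded subsets of a compactly embedded cone are relatively compact. -/
lemma CompactlyEmbedded.isCompact_closure (hM : M.CompactlyEmbedded) (R : ℝ) :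
    IsCompact (closure {b | b ∈ M.carrier ∧ M.gauge b ≤ R}) := by
  refine IsSeqCompact.isCompact ?_
  intro x hx
  -- The compactness hypothesis concerns sequences in the cone, so points of the closure are first
  -- replaced by nearby cone elements.
  have : ∀ n : ℕ, ∃ b ∈ {b | b ∈ M.carrier ∧ M.gauge b ≤ R}, dist (x n) b < 1 / ((n : ℝ) + 1) :=
    fun n => Metric.mem_closure_iff.1 (hx n) _ (by positivity)
  choose b hb hxb using this
  obtain ⟨φ, hφ, a, ha⟩ := hM b (fun n => (hb n).1) ⟨R, fun n => (hb n).2⟩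
  refine ⟨a, mem_closure_of_tendsto ha (Eventually.of_forall fun n => hb _), φ, hφ, ?_⟩
  have hd : Tendsto (fun n => dist (b (φ n)) (x (φ n))) atTop (𝓝 0) := by
    refine squeeze_zero (fun n => dist_nonneg) (fun n => ?_)
      (tendsto_one_div_add_atTop_nhds_zero_nat.comp hφ.tendsto_atTop)
    rw [dist_comm]
    exact (hxb _).le
  exact (tendsto_iff_of_dist hd).1 ha

/-- Ehrling's inequality for differences of elements of a compactly embedded cone. -/
lemma CompactlyEmbedded.norm_sub_le {Y : Type*} [NormedAddCommGroup Y] [NormedSpace ℝ Y]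
    (hM : M.CompactlyEmbedded) {ιB : B →ₗ[ℝ] E} {ιY : Y →ₗ[ℝ] E}
    (hlim : LimitCompatible ιB ιY) {ε : ℝ} (hε : 0 < ε) :
    ∃ C : ℝ, 0 ≤ C ∧ ∀ a ∈ M.carrier, ∀ b ∈ M.carrier, ∀ y : Y, ιB (a - b) = ιY y →
      ‖a - b‖ ≤ ε * (M.gauge a + M.gauge b) + C * ‖y‖ := by
  by_contra! hcon
  -- Counterexamples to the inequality with constant `C = n`.
  choose a ha b hb y hy hlt using fun n : ℕ => hcon n n.cast_nonneg
  set σ : ℕ → ℝ := fun n => M.gauge (a n) + M.gauge (b n) with hσ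
  have ha0 := fun n => M.gauge_nonneg _ (ha n)
  have hb0 := fun n => M.gauge_nonneg _ (hb n)
  have hσpos : ∀ n, 0 < σ n := fun n => by
    refine (add_nonneg (ha0 n) (hb0 n)).lt_of_ne' fun h0 => ?_
    have h1 : a n = 0 := (M.gauge_eq_zero_iff _ (ha n)).1 (by linarith [ha0 n, hb0 n])
    have h2 : b n = 0 := (M.gauge_eq_zero_iff _ (hb n)).1 (by linarith [ha0 n, hb0 n])
    have h3 := hlt n
    rw [h0, h1, h2, sub_zero, norm_zero, mul_zero, zero_add] at h3
    exact absurd h3 (not_lt.2 (by positivity))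
  -- Both elements are divided by the same `σ n`: each then has gauge at most 1, and subsequences
  -- are extracted for each separately, because the gauge says nothing about their difference.
  have hinv : ∀ n, 0 ≤ (σ n)⁻¹ := fun n => (inv_pos.2 (hσpos n)).le
  have hbound : ∀ c : ℕ → B, (∀ n, c n ∈ M.carrier) → (∀ n, M.gauge (c n) ≤ σ n) →
      ∀ n, M.gauge ((σ n)⁻¹ • c n) ≤ 1 := fun c hc hc' n => by
    rw [M.gauge_smul _ (hc n) _ (hinv n), inv_mul_le_iff₀ (hσpos n), mul_one]
    exact hc' n
  obtain ⟨φ, hφ, a', ha'⟩ := hM (fun n => (σ n)⁻¹ • a n)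
    (fun n => M.smul_mem _ (ha n) _ (hinv n))
    ⟨1, hbound a ha fun n => by linarith [hb0 n]⟩
  obtain ⟨ψ, hψ, b', hb'⟩ := hM (fun n => (σ (φ n))⁻¹ • b (φ n))
    (fun n => M.smul_mem _ (hb _) _ (hinv _))
    ⟨1, fun n => hbound b hb (fun n => by linarith [ha0 n]) (φ n)⟩
  set θ : ℕ → ℕ := fun n => φ (ψ n) with hθdef
  have hθ : StrictMono θ := hφ.comp hψ
  have hw : Tendsto (fun n => (σ (θ n))⁻¹ • (a (θ n) - b (θ n))) atTop (𝓝 (a' - b')) := by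
    simp only [smul_sub]
    exact (ha'.comp hψ.tendsto_atTop).sub hb'
  -- This is used twice: boundedness of the right side forces the rescaled `y` to 0, hence the limit
  -- in `B` vanishes, while the term `ε` keeps the norms away from 0.
  have hnorm : ∀ n, ε + n * ‖(σ n)⁻¹ • y n‖ ≤ ‖(σ n)⁻¹ • (a n - b n)‖ := fun n => by
    rw [norm_smul, norm_smul, Real.norm_of_nonneg (hinv n), ← sub_nonneg]
    have h1 : (σ n)⁻¹ * ‖a n - b n‖ - (ε + n * ((σ n)⁻¹ * ‖y n‖))
        = (σ n)⁻¹ * (‖a n - b n‖ - (ε * σ n + n * ‖y n‖)) := by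
      have := (hσpos n).ne'
      field_simp
    rw [h1]
    exact mul_nonneg (hinv n) (sub_nonneg.2 (hlt n).le)
  obtain ⟨K, hK⟩ := hw.norm.bddAbove_range
  have hK' : ∀ n, ‖(σ (θ n))⁻¹ • (a (θ n) - b (θ n))‖ ≤ K := fun n => hK ⟨n, rfl⟩
  have hy0 : Tendsto (fun n => (σ (θ n))⁻¹ • y (θ n)) atTop (𝓝 0) := by
    have hdiv : Tendsto (fun n => K / (θ n : ℝ)) atTop (𝓝 0) :=
      tendsto_const_nhds.div_atTop (tendsto_natCast_atTop_atTop.comp hθ.tendsto_atTop)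
    refine squeeze_zero_norm' ?_ hdiv
    filter_upwards [hθ.tendsto_atTop.eventually_gt_atTop 0] with n hn
    rw [le_div_iff₀ (by exact_mod_cast hn), mul_comm]
    linarith [hnorm (θ n), hK' n]
  have hzero := hlim _ _ _ (fun n => by rw [map_smul, map_smul, hy]) hw hy0
  rw [hzero] at hw
  have h0 : ε ≤ ‖(0 : B)‖ := ge_of_tendsto' hw.norm fun n =>
    (le_add_of_nonneg_right (by positivity)).trans (hnorm (θ n))
  rw [norm_zero] at h0
  exact absurd h0 (not_le.2 hε)

end SeminormedCone

end AubinLions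

/-! ### Equipartitions and step approximation in `L^p` -/

namespace AubinLions

/-- Superadditivity of `x ↦ x ^ q`. It bounds the `q`-th powers of the cell integrals of the
derivative by its `L^1` norm alone, which is why `r = 1` suffices for finite `p`. -/
lemma sum_rpow_le_rpow_sum {ι : Type*} (s : Finset ι) (a : ι → ℝ≥0∞) {q : ℝ} (hq : 1 ≤ q) :
    ∑ i ∈ s, a i ^ q ≤ (∑ i ∈ s, a i) ^ q := by
  classical
  induction s using Finset.induction_on with
  | empty => simp
  | insert i s hi ih =>
    rw [Finset.sum_insert hi, Finset.sum_insert hi]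
    exact (add_le_add_right ih _).trans (ENNReal.add_rpow_le_rpow_add _ _ hq)

/-- A monotone indexing of the `n + 1` intervals of equal length partitioning `(0, T)`. -/
lemma exists_equipartition {T : ℝ} (hT : 0 < T) (n : ℕ) :
    ∃ κ : ℝ → Fin (n + 1), Monotone κ ∧
      ∀ k, timeMeasure T (κ ⁻¹' {k}) = ENNReal.ofReal (T / ((n : ℝ) + 1)) := by
  have hn : (0 : ℝ) < n + 1 := by positivity
  set h : ℝ := T / (n + 1) with hh
  have hpos : 0 < h := by positivity
  have hTh : T = (n + 1) * h := by rw [hh]; field_simp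
  -- The truncation at `n` only makes the index total; on `(0, T)` the floor is already at most `n`.
  let κ : ℝ → Fin (n + 1) := fun t => ⟨min ⌊t / h⌋₊ n, by omega⟩
  have hmono : Monotone κ := fun a b hab => by
    simp only [κ, Fin.mk_le_mk]
    exact min_le_min_right _ (Nat.floor_mono (by gcongr))
  refine ⟨κ, hmono, fun k => ?_⟩
  have hmeas : MeasurableSet (κ ⁻¹' {k}) := hmono.measurable (measurableSet_singleton k)
  have hk : (k : ℝ) + 1 ≤ n + 1 := by
    have : (k : ℕ) + 1 ≤ n + 1 := k.2
    exact_mod_cast this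
  -- A cell is squeezed between an open and a half-open interval of the same length, since the first
  -- cell lacks its endpoint 0.
  have hvol : volume (Ioo (k * h) ((k + 1) * h)) = ENNReal.ofReal h := by
    rw [Real.volume_Ioo]; congr 1; ring
  have hvol' : volume (Ico (k * h) ((k + 1) * h)) = ENNReal.ofReal h := by
    rw [Real.volume_Ico]; congr 1; ring
  have hfloor : ∀ t, t ∈ Ico (k * h) ((k + 1) * h) → ⌊t / h⌋₊ = k := fun t ht => by
    have h0 : (0 : ℝ) ≤ k * h := by positivity
    rw [Nat.floor_eq_iff (div_nonneg (h0.trans ht.1) hpos.le), le_div_iff₀ hpos,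
      div_lt_iff₀ hpos]
    exact ht
  rw [Measure.restrict_apply hmeas]
  apply le_antisymm
  · rw [← hvol']
    refine measure_mono ?_
    rintro t ⟨htk, ht0, htT⟩
    have hlt : ⌊t / h⌋₊ < n + 1 := by
      rw [Nat.floor_lt (by positivity), div_lt_iff₀ hpos]
      push_cast
      rwa [← hTh]
    have heq : min ⌊t / h⌋₊ n = k := congrArg Fin.val (show κ t = k from htk)
    rw [min_eq_left (by omega), Nat.floor_eq_iff (by positivity), le_div_iff₀ hpos,
      div_lt_iff₀ hpos] at heq
    exact heq
  · rw [← hvol]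
    refine measure_mono fun t ht => ⟨?_, ?_, ?_⟩
    · refine Fin.ext (?_ : min ⌊t / h⌋₊ n = k)
      rw [hfloor t (Ioo_subset_Ico_self ht)]
      omega
    · exact lt_of_le_of_lt (by positivity) ht.1
    · refine ht.2.trans_le ?_
      rw [hTh]
      gcongr

section Partition

variable {α : Type*} [MeasurableSpace α] {μ : Measure α} {m : ℕ} {κ : α → Fin m}

lemma lintegral_comp_fin (hκ : Measurable κ) (F : Fin m → ℝ≥0∞) :
    ∫⁻ t, F (κ t) ∂μ = ∑ k, F k * μ (κ ⁻¹' {k}) := by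
  rw [← lintegral_map (f := F) (measurable_of_finite F) hκ, lintegral_fintype]
  simp only [Measure.map_apply hκ (measurableSet_singleton _)]

lemma sum_setLIntegral_fiber (hκ : Measurable κ) (F : α → ℝ≥0∞) :
    ∑ k, ∫⁻ t in κ ⁻¹' {k}, F t ∂μ = ∫⁻ t, F t ∂μ := by
  have h := lintegral_iUnion (μ := μ) (fun k : Fin m => hκ (measurableSet_singleton k))
    (fun i j hij => Disjoint.preimage κ (disjoint_singleton.2 hij)) F
  rw [tsum_fintype, ← preimage_iUnion, iUnion_of_singleton, preimage_univ,
    Measure.restrict_univ] at h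
  exact h.symm

/-- Choice of a point in each cell at which `g` does not exceed its mean over the cell. -/
lemma exists_point_le_setLIntegral [IsFiniteMeasure μ] (hκ : Measurable κ)
    (hμ : ∀ k, μ (κ ⁻¹' {k}) ≠ 0) {g : α → ℝ≥0∞} (hg : AEMeasurable g μ) {G : Set α}
    (hG : ∀ᵐ t ∂μ, t ∈ G) :
    ∃ s : Fin m → α, ∀ k, s k ∈ G ∧ κ (s k) = k ∧
      g (s k) * μ (κ ⁻¹' {k}) ≤ ∫⁻ t in κ ⁻¹' {k}, g t ∂μ := by
  have key : ∀ k, ∃ s, s ∈ G ∧ κ s = k ∧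
      g s * μ (κ ⁻¹' {k}) ≤ ∫⁻ t in κ ⁻¹' {k}, g t ∂μ := fun k => by
    have hm : MeasurableSet (κ ⁻¹' {k}) := hκ (measurableSet_singleton k)
    have hN : μ.restrict (κ ⁻¹' {k}) {t | ¬ (t ∈ G ∧ κ t = k)} = 0 := by
      change ∀ᵐ t ∂μ.restrict (κ ⁻¹' {k}), t ∈ G ∧ κ t = k
      filter_upwards [ae_restrict_of_ae hG, ae_restrict_mem hm] with t h1 h2
      exact ⟨h1, h2⟩
    obtain ⟨s, hs, hle⟩ := exists_notMem_null_le_laverage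
      (by simpa [Measure.restrict_eq_zero] using hμ k) hg.restrict hN
    have hs' : s ∈ G ∧ κ s = k := by simpa using hs
    refine ⟨s, hs'.1, hs'.2, ?_⟩
    rw [setLAverage_eq] at hle
    exact (ENNReal.le_div_iff_mul_le (Or.inl (hμ k)) (Or.inl (measure_ne_top _ _))).1 hle
  choose s hs using key
  exact ⟨s, hs⟩

end Partition

section StepApproximation

variable {B Y : Type*} [NormedAddCommGroup B] [NormedAddCommGroup Y]

lemma lintegral_rpow_const_mul {α : Type*} [MeasurableSpace α] {μ : Measure α} {q : ℝ}
    (hq : 0 < q) (c : ℝ≥0) (F : α → ℝ≥0∞) :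
    (∫⁻ t, (c * F t) ^ q ∂μ) ^ (1 / q) = c * (∫⁻ t, F t ^ q ∂μ) ^ (1 / q) := by
  simp only [ENNReal.mul_rpow_of_nonneg _ _ hq.le]
  rw [lintegral_const_mul' _ _ (ENNReal.rpow_ne_top_of_nonneg hq.le ENNReal.coe_ne_top),
    ENNReal.mul_rpow_of_nonneg _ _ (by positivity), ← ENNReal.rpow_mul, mul_one_div_cancel hq.ne',
    ENNReal.rpow_one]

/-- Approximation of a function by a step function on an equipartition, with values taken at
points where the function `γ` is controlled. -/
lemma exists_step_approximation {T : ℝ} {n : ℕ} {h : ℝ≥0∞} (hh : h ≠ 0)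
    {κ : ℝ → Fin (n + 1)} (hκ : Monotone κ) (hκh : ∀ k, timeMeasure T (κ ⁻¹' {k}) = h)
    {p : ℝ≥0∞} (hp : 1 ≤ p) (hp' : p ≠ ⊤) {u : ℝ → B} {γ : ℝ → ℝ} {f : ℝ → Y}
    (hγ : AEStronglyMeasurable γ (timeMeasure T))
    {G : Set ℝ} (hG : ∀ᵐ t ∂timeMeasure T, t ∈ G)
    {ε C : ℝ≥0} (hle : ∀ s ∈ G, ∀ t ∈ G, ‖u t - u s‖ₑ ≤
      ε * (‖γ t‖ₑ + ‖γ s‖ₑ) + C * ∫⁻ x in uIcc s t, ‖f x‖ₑ ∂timeMeasure T) :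
    ∃ s : Fin (n + 1) → ℝ, (∀ k, s k ∈ G) ∧
      (∀ k, ‖γ (s k)‖ₑ ≤ eLpNorm γ p (timeMeasure T) / h ^ (1 / p.toReal)) ∧
      eLpNorm (fun t => u t - u (s (κ t))) p (timeMeasure T) ≤
        ε * (eLpNorm γ p (timeMeasure T) + eLpNorm γ p (timeMeasure T)) +
          C * (eLpNorm f 1 (timeMeasure T) * h ^ (1 / p.toReal)) := by
  have hp0 : p ≠ 0 := (zero_lt_one.trans_le hp).ne'
  set q := p.toReal with hq
  have hq1 : 1 ≤ q := by
    rw [hq, ← ENNReal.toReal_one]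
    exact ENNReal.toReal_mono hp' hp
  have hq0 : 0 < q := zero_lt_one.trans_le hq1
  set μ := timeMeasure T with hμ
  have hκm : Measurable κ := hκ.measurable
  have hhtop : h ≠ ⊤ := hκh 0 ▸ measure_ne_top _ _
  have hγq : AEMeasurable (fun t => ‖γ t‖ₑ ^ q) μ := hγ.enorm.pow_const q
  obtain ⟨s, hs⟩ := exists_point_le_setLIntegral hκm (fun k => by rwa [hκh]) hγq hG
  have hγnorm : eLpNorm γ p μ = (∫⁻ t, ‖γ t‖ₑ ^ q ∂μ) ^ (1 / q) :=
    eLpNorm_eq_lintegral_rpow_enorm_toReal hp0 hp'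
  refine ⟨s, fun k => (hs k).1, fun k => ?_, ?_⟩
  · have hh' : h ^ (1 / q) ≠ 0 := by
      simp [ENNReal.rpow_eq_zero_iff, hh, hhtop]
    have hh'' : h ^ (1 / q) ≠ ⊤ := ENNReal.rpow_ne_top_of_nonneg (by positivity) hhtop
    rw [ENNReal.le_div_iff_mul_le (Or.inl hh') (Or.inl hh''), hγnorm]
    -- The mean over one cell is crudely bounded by the whole integral; the resulting bound depends
    -- on `h` but not on the particular function beyond its norm.
    have h1 : ‖γ (s k)‖ₑ ^ q * h ≤ ∫⁻ t, ‖γ t‖ₑ ^ q ∂μ := by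
      have := (hs k).2.2
      rw [hκh] at this
      exact this.trans (setLIntegral_le_lintegral _ _)
    calc ‖γ (s k)‖ₑ * h ^ (1 / q) = (‖γ (s k)‖ₑ ^ q * h) ^ (1 / q) := by
          rw [ENNReal.mul_rpow_of_nonneg _ _ (by positivity), ← ENNReal.rpow_mul,
            mul_one_div_cancel hq0.ne', ENNReal.rpow_one]
      _ ≤ _ := ENNReal.rpow_le_rpow h1 (by positivity)
  · set A : Fin (n + 1) → ℝ≥0∞ := fun k => ∫⁻ x in κ ⁻¹' {k}, ‖f x‖ₑ ∂μ with hA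
    have hstep : ∀ F : Fin (n + 1) → ℝ≥0∞, Measurable fun t => F (κ t) := fun F =>
      (measurable_of_finite F).comp hκm
    have hpt : ∀ᵐ t ∂μ, ‖u t - u (s (κ t))‖ₑ ≤
        (ε * ‖γ t‖ₑ + ε * ‖γ (s (κ t))‖ₑ) + C * A (κ t) := by
      filter_upwards [hG] with t ht
      refine (hle _ (hs (κ t)).1 t ht).trans ?_
      rw [mul_add]
      gcongr
      refine lintegral_mono_set fun x hx => ?_
      -- Cells of a monotone index are intervals, so the segment from the sample to `t` stays in one
      -- cell.
      have hord : OrdConnected (κ ⁻¹' {κ t}) := ordConnected_singleton.preimage_mono hκ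
      exact hord.uIcc_subset (hs (κ t)).2.1 rfl hx
    have hN1 : (∫⁻ t, (ε * ‖γ t‖ₑ) ^ q ∂μ) ^ (1 / q) = ε * eLpNorm γ p μ := by
      rw [lintegral_rpow_const_mul hq0, hγnorm]
    have hN2 : (∫⁻ t, (ε * ‖γ (s (κ t))‖ₑ) ^ q ∂μ) ^ (1 / q) ≤ ε * eLpNorm γ p μ := by
      rw [lintegral_rpow_const_mul hq0 ε fun t => ‖γ (s (κ t))‖ₑ, hγnorm]
      refine mul_le_mul_right (ENNReal.rpow_le_rpow ?_ (by positivity)) _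
      rw [lintegral_comp_fin hκm fun k => ‖γ (s k)‖ₑ ^ q, ← sum_setLIntegral_fiber hκm]
      exact Finset.sum_le_sum fun k _ => (hs k).2.2
    have hN3 : (∫⁻ t, (C * A (κ t)) ^ q ∂μ) ^ (1 / q) ≤ C * (eLpNorm f 1 μ * h ^ (1 / q)) := by
      rw [lintegral_rpow_const_mul hq0 C fun t => A (κ t)]
      gcongr
      rw [lintegral_comp_fin hκm fun k => A k ^ q]
      simp only [hκh]
      rw [← Finset.sum_mul, eLpNorm_one_eq_lintegral_enorm,
        ← sum_setLIntegral_fiber hκm]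
      refine (ENNReal.rpow_le_rpow (mul_le_mul_left (sum_rpow_le_rpow_sum _ _ hq1) _)
        (by positivity)).trans_eq ?_
      rw [ENNReal.mul_rpow_of_nonneg _ _ (by positivity), ← ENNReal.rpow_mul,
        mul_one_div_cancel hq0.ne', ENNReal.rpow_one]
    rw [eLpNorm_eq_lintegral_rpow_enorm_toReal hp0 hp', ← hq]
    have hm1 : AEMeasurable (fun t => (ε : ℝ≥0∞) * ‖γ t‖ₑ) μ := hγ.enorm.const_mul _
    have hm2 : AEMeasurable (fun t => (ε : ℝ≥0∞) * ‖γ (s (κ t))‖ₑ) μ :=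
      ((hstep fun k => ‖γ (s k)‖ₑ).const_mul _).aemeasurable
    have hm3 : AEMeasurable (fun t => (C : ℝ≥0∞) * A (κ t)) μ :=
      ((hstep A).const_mul _).aemeasurable
    calc (∫⁻ t, ‖u t - u (s (κ t))‖ₑ ^ q ∂μ) ^ (1 / q)
        ≤ (∫⁻ t, (((fun t => (ε : ℝ≥0∞) * ‖γ t‖ₑ) + fun t => (ε : ℝ≥0∞) * ‖γ (s (κ t))‖ₑ) +
            fun t => (C : ℝ≥0∞) * A (κ t)) t ^ q ∂μ) ^ (1 / q) := by
          refine ENNReal.rpow_le_rpow (lintegral_mono_ae ?_) (by positivity)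
          filter_upwards [hpt] with t ht
          exact ENNReal.rpow_le_rpow ht hq0.le
      _ ≤ _ := (ENNReal.lintegral_Lp_add_le (hm1.add hm2) hm3 hq1).trans
          (add_le_add_left (ENNReal.lintegral_Lp_add_le hm1 hm2 hq1) _)
      _ ≤ (ε * eLpNorm γ p μ + ε * eLpNorm γ p μ) + C * (eLpNorm f 1 μ * h ^ (1 / q)) :=
          add_le_add (add_le_add hN1.le hN2) hN3
      _ = _ := by rw [mul_add]

end StepApproximation

/-! ### Total boundedness through compact approximations -/

section ToLp

variable {α B X : Type*} [MeasurableSpace α] {μ : Measure α} [IsFiniteMeasure μ]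
  [NormedAddCommGroup B] [PseudoMetricSpace X] {p : ℝ≥0∞} [Fact (1 ≤ p)]

/-- On a finite measure space, a uniformly continuous family of functions is continuous
in `L^p`. -/
lemma continuous_toLp_of_norm_sub_le {F : X → α → B} (hF : ∀ x, MemLp (F x) p μ)
    (hd : ∀ x y t, ‖F x t - F y t‖ ≤ dist x y) : Continuous fun x => (hF x).toLp (F x) := by
  have htop : μ univ ^ p.toReal⁻¹ ≠ ⊤ :=
    ENNReal.rpow_ne_top_of_nonneg (by positivity) (measure_ne_top _ _)
  refine LipschitzWith.continuous (K := (μ univ ^ p.toReal⁻¹).toNNReal) fun x y => ?_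
  rw [Lp.edist_toLp_toLp, ENNReal.coe_toNNReal htop, edist_dist]
  exact eLpNorm_le_of_ae_bound (Eventually.of_forall (hd x y))

end ToLp

/-- A set that is uniformly approximated by compact sets is totally bounded. -/
lemma totallyBounded_of_forall_exists_isCompact {X : Type*} [PseudoMetricSpace X] {U : Set X}
    (h : ∀ δ > 0, ∃ K : Set X, IsCompact K ∧ ∀ u ∈ U, ∃ x ∈ K, dist u x ≤ δ) :
    TotallyBounded U := by
  rw [Metric.totallyBounded_iff]
  intro ε hε
  obtain ⟨K, hK, hU⟩ := h (ε / 2) (half_pos hε)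
  obtain ⟨t, ht, hcov⟩ := Metric.totallyBounded_iff.1 hK.totallyBounded (ε / 2) (half_pos hε)
  refine ⟨t, ht, fun u hu => ?_⟩
  obtain ⟨x, hx, hux⟩ := hU u hu
  obtain ⟨y, hy, hxy⟩ := mem_iUnion₂.1 (hcov hx)
  refine mem_iUnion₂.2 ⟨y, hy, ?_⟩
  rw [Metric.mem_ball] at hxy ⊢
  linarith [dist_triangle u x y]

end AubinLions

/-! ### Continuous representatives and equicontinuity -/

namespace AubinLions

section Uniform

variable {B Y : Type*} [NormedAddCommGroup B] [NormedAddCommGroup Y] {T : ℝ} {r : ℝ≥0∞}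

/-- Points of a conull set are dense in the closed time interval. -/
lemma dense_of_ae_timeMeasure (hT : 0 < T) {G : Set ℝ} (hG : ∀ᵐ t ∂timeMeasure T, t ∈ G) :
    Dense {x : Icc (0 : ℝ) T | (x : ℝ) ∈ G} := by
  have h1 : Dense {t : ℝ | t ∈ Ioo 0 T → t ∈ G} :=
    Measure.dense_of_ae ((ae_restrict_iff' measurableSet_Ioo).1 hG)
  rw [Subtype.dense_iff, ← closure_Ioo hT.ne]
  refine closure_minimal ((h1.open_subset_closure_inter isOpen_Ioo).trans
    (closure_mono ?_)) isClosed_closure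
  rw [closure_Ioo hT.ne]
  rintro t ⟨ht, ht'⟩
  exact ⟨⟨t, Ioo_subset_Icc_self ht⟩, ht' ht, rfl⟩

/-- A function which is uniformly continuous on a conull set has a continuous representative. -/
lemma exists_continuous_extension [CompleteSpace B] (hT : 0 < T) {G : Set ℝ}
    (hG : ∀ᵐ t ∂timeMeasure T, t ∈ G) {u : ℝ → B}
    (hu : ∀ ε > 0, ∃ δ > 0, ∀ s ∈ G, ∀ t ∈ G, dist s t < δ → dist (u s) (u t) ≤ ε) :
    ∃ f : C(Icc (0 : ℝ) T, B), ∀ x : Icc (0 : ℝ) T, (x : ℝ) ∈ G → f x = u x := by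
  set S : Set (Icc (0 : ℝ) T) := {x | (x : ℝ) ∈ G} with hS
  have hdense : Dense S := dense_of_ae_timeMeasure hT hG
  have huc : UniformContinuous fun x : S => u x := by
    rw [Metric.uniformContinuous_iff]
    intro ε hε
    obtain ⟨δ, hδ, h⟩ := hu (ε / 2) (half_pos hε)
    exact ⟨δ, hδ, fun x y hxy => (h _ x.2 _ y.2 hxy).trans_lt (half_lt_self hε)⟩
  exact ⟨⟨hdense.extend fun x : S => u x, (hdense.uniformContinuous_extend huc).continuous⟩,
    fun x hx => hdense.extend_of_ind huc ⟨x, hx⟩⟩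

/-- A modulus of continuity on a dense set passes to the whole space. -/
lemma dist_le_of_dense {X Z : Type*} [PseudoMetricSpace X] [PseudoMetricSpace Z] {S : Set X}
    (hS : Dense S) {f : X → Z} (hf : Continuous f) {δ ε : ℝ}
    (h : ∀ x ∈ S, ∀ y ∈ S, dist x y < δ → dist (f x) (f y) ≤ ε) {x y : X} (hxy : dist x y < δ) :
    dist (f x) (f y) ≤ ε := by
  have hd : Dense (S ×ˢ S) := hS.prod hS
  have hopen : IsOpen {z : X × X | dist z.1 z.2 < δ} := isOpen_lt (by fun_prop) (by fun_prop)
  have hclosed : IsClosed {z : X × X | dist (f z.1) (f z.2) ≤ ε} :=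
    isClosed_le (by fun_prop) (by fun_prop)
  exact closure_minimal (fun z hz => h _ hz.2.1 _ hz.2.2 hz.1) hclosed
    (hd.open_subset_closure_inter hopen (show (x, y) ∈ _ from hxy))

/-- The Arzelà–Ascoli theorem in `C(X, B)` for a uniform modulus of continuity. -/
lemma isCompact_closure_of_modulus {X : Type*} [PseudoMetricSpace X] [CompactSpace X]
    {F : Set C(X, B)} {K : Set B} (hK : IsCompact K) (hFK : ∀ f ∈ F, ∀ x, f x ∈ K)
    (hmod : ∀ ε > 0, ∃ δ > 0, ∀ f ∈ F, ∀ x y, dist x y < δ → dist (f x) (f y) ≤ ε) :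
    IsCompact (closure F) := by
  let e := (ContinuousMap.isometryEquivBoundedOfCompact X B).toHomeomorph
  rw [← e.isCompact_image, e.image_closure]
  refine BoundedContinuousFunction.arzela_ascoli K hK _ ?_ ?_
  · rintro _ x ⟨f, hf, rfl⟩
    exact hFK f hf x
  · refine UniformEquicontinuous.equicontinuous ?_
    rw [Metric.uniformEquicontinuous_iff]
    intro ε hε
    obtain ⟨δ, hδ, h⟩ := hmod (ε / 2) (half_pos hε)
    refine ⟨δ, hδ, fun x y hxy => ?_⟩
    rintro ⟨_, f, hf, rfl⟩
    exact (h f hf x y hxy).trans_lt (half_lt_self hε)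

/-- A bound in `L^r` with `r > 1` makes the integrals over short intervals uniformly small. -/
lemma exists_setLIntegral_uIcc_le (hr : 1 < r) (C D : ℝ≥0) {ε : ℝ≥0} (hε : 0 < ε) :
    ∃ δ > 0, ∀ f : ℝ → Y, AEStronglyMeasurable f (timeMeasure T) →
      eLpNorm f r (timeMeasure T) ≤ D → ∀ s t : ℝ, dist s t < δ →
        C * ∫⁻ x in uIcc s t, ‖f x‖ₑ ∂timeMeasure T ≤ ε := by
  -- The Hölder exponent; for `r = ⊤` the convention `toReal = 0` gives `a = 1`, the correct value.
  set a : ℝ := 1 - 1 / r.toReal with ha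
  have ha0 : 0 < a := by
    rcases eq_or_ne r ⊤ with rfl | hr'
    · simp [ha]
    · have h1 : 1 < r.toReal := by
        rw [← ENNReal.toReal_one]
        exact (ENNReal.toReal_lt_toReal ENNReal.one_ne_top hr').2 hr
      rw [ha, sub_pos, div_lt_one (by linarith)]
      exact h1
  have hlim : Tendsto (fun x : ℝ => (C : ℝ≥0∞) * (D * ENNReal.ofReal x ^ a)) (𝓝 0) (𝓝 0) := by
    have h2 := (ENNReal.tendsto_ofReal (tendsto_id (α := ℝ) (x := 𝓝 0))).ennrpow_const a
    rw [ENNReal.ofReal_zero, ENNReal.zero_rpow_of_pos ha0] at h2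
    have h3 := ENNReal.Tendsto.const_mul (a := (C : ℝ≥0∞)) (ENNReal.Tendsto.const_mul
      (a := (D : ℝ≥0∞)) h2 (Or.inr ENNReal.coe_ne_top)) (Or.inr ENNReal.coe_ne_top)
    simpa using h3
  obtain ⟨δ, hδ, h⟩ := Metric.eventually_nhds_iff.1 (hlim.eventually_le_const
    (show (0 : ℝ≥0∞) < ε by exact_mod_cast hε))
  refine ⟨δ, hδ, fun f hf hfD s t hst => le_trans ?_ (h (y := dist s t) (by simpa using hst))⟩
  gcongr
  rw [← eLpNorm_one_eq_lintegral_enorm]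
  refine (eLpNorm_le_eLpNorm_mul_rpow_measure_univ hr.le hf.restrict).trans ?_
  rw [ENNReal.toReal_one, div_one]
  gcongr
  · exact (eLpNorm_mono_measure _ Measure.restrict_le_self).trans hfD
  · rw [Measure.restrict_apply_univ, dist_comm, Real.dist_eq, ← Real.volume_interval]
    exact Measure.restrict_le_self _

lemma eLpNorm_le_toNNReal_of_norm_le {v' : Lp Y r (timeMeasure T)} {C : ℝ} (h : ‖v'‖ ≤ C) :
    eLpNorm v' r (timeMeasure T) ≤ C.toNNReal := by
  rw [← ENNReal.ofReal_toReal (Lp.eLpNorm_ne_top v'), ← Lp.norm_def]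
  exact ENNReal.ofReal_le_ofReal h

end Uniform

/-! ### Increments of `u` in `B` and the two cases of the theorem -/

variable {B Y E : Type*} [NormedAddCommGroup B] [NormedSpace ℝ B]
  [NormedAddCommGroup Y] [NormedSpace ℝ Y] [AddCommGroup E] [Module ℝ E]
  {ιB : B →ₗ[ℝ] E} {ιY : Y →ₗ[ℝ] E} {M : SeminormedCone B} {T : ℝ} {p r : ℝ≥0∞}

lemma SeminormedCone.CompactlyEmbedded.enorm_sub_le (hM : M.CompactlyEmbedded)
    (hlim : LimitCompatible ιB ιY) {ε : ℝ≥0} (hε : 0 < ε) :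
    ∃ C : ℝ≥0, ∀ a ∈ M.carrier, ∀ b ∈ M.carrier, ∀ y : Y, ιB (a - b) = ιY y →
      ‖a - b‖ₑ ≤ ε * (‖M.gauge a‖ₑ + ‖M.gauge b‖ₑ) + C * ‖y‖ₑ := by
  obtain ⟨C, hC, h⟩ := hM.norm_sub_le hlim (NNReal.coe_pos.2 hε)
  lift C to ℝ≥0 using hC
  refine ⟨C, fun a ha b hb y hy => ?_⟩
  have h1 := h a ha b hb y hy
  rw [← Real.norm_of_nonneg (M.gauge_nonneg a ha), ← Real.norm_of_nonneg (M.gauge_nonneg b hb)]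
    at h1
  simp only [enorm_eq_nnnorm]
  exact_mod_cast h1

/-- Up to null sets, differences of values of `u` are controlled by the gauge and by the
integral of a bounded family of densities, the latter with a factor depending on `ε`. -/
lemma exists_ae_enorm_sub_le [CompleteSpace Y] (hp : 1 ≤ p) (hr : 1 ≤ r)
    {u : Lp B p (timeMeasure T)} (hu : M.MemLpCone u) {v : Lp Y p (timeMeasure T)}
    (huv : SameFunction ιB ιY u v) {v' : Lp Y r (timeMeasure T)} (hv : HasWeakTimeDeriv v v') :
    ∃ G : Set ℝ, (∀ᵐ t ∂timeMeasure T, t ∈ G) ∧ (∀ t ∈ G, u t ∈ M.carrier) ∧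
      ∀ (ε C : ℝ≥0), (∀ a ∈ M.carrier, ∀ b ∈ M.carrier, ∀ y : Y, ιB (a - b) = ιY y →
          ‖a - b‖ₑ ≤ ε * (‖M.gauge a‖ₑ + ‖M.gauge b‖ₑ) + C * ‖y‖ₑ) →
        ∀ s ∈ G, ∀ t ∈ G, ‖u t - u s‖ₑ ≤ ε * (‖M.gauge (u t)‖ₑ + ‖M.gauge (u s)‖ₑ) +
          C * ∫⁻ x in uIcc s t, ‖v' x‖ₑ ∂timeMeasure T := by
  obtain ⟨G, hG, hle⟩ := exists_ae_enorm_sub_le_of_weakDeriv ((Lp.memLp v).integrable hp)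
    ((Lp.memLp v').integrable hr) hv
  refine ⟨{t | t ∈ G ∧ u t ∈ M.carrier ∧ ιB (u t) = ιY (v t)}, ?_, fun t ht => ht.2.1, ?_⟩
  · filter_upwards [hG, hu.1, huv] with t h1 h2 h3
    exact ⟨h1, h2, h3⟩
  rintro ε C h s ⟨hs, hsM, hsv⟩ t ⟨ht, htM, htv⟩
  refine (h _ htM _ hsM (v t - v s) (by rw [map_sub, map_sub, hsv, htv])).trans ?_
  gcongr
  rcases le_total s t with hst | hst
  · rw [uIcc_of_le hst]
    exact hle s hs t ht hst
  · rw [uIcc_of_ge hst, ← enorm_neg, neg_sub]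
    exact hle t ht s hs hst

/-- Half of the tolerance goes to the two gauge terms, each bounded by `K`; the `+ 1` allows `K =
0`. -/
lemma mul_add_self_le_half (δ K : ℝ≥0) : δ / (4 * (K + 1)) * (K + K) ≤ δ / 2 := by
  rw [div_mul_eq_mul_div, div_le_iff₀ (by positivity)]
  calc δ * (K + K) ≤ δ * (K + K) + 2 * δ := le_self_add
    _ = δ / 2 * (4 * (K + 1)) := by field_simp; ring

/-- The case of finite exponents. -/
theorem isCompact_closure_of_lt_top [CompleteSpace B] [CompleteSpace Y] [Fact (1 ≤ p)]
    (hT : 0 < T) (hp' : p ≠ ⊤)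
    (hcompact : M.CompactlyEmbedded) (hlimit : LimitCompatible ιB ιY)
    {U : Set (Lp B p (timeMeasure T))} (hUM : M.BoundedInLpCone U)
    (hderiv : BoundedTimeDeriv ιB ιY U 1) : IsCompact (closure U) := by
  have hp : 1 ≤ p := Fact.out
  obtain ⟨K, hK⟩ := hUM
  obtain ⟨D, hD⟩ := hderiv
  refine TotallyBounded.isCompact_of_isClosed (TotallyBounded.closure ?_) isClosed_closure
  refine totallyBounded_of_forall_exists_isCompact fun δ hδ => ?_
  lift δ to ℝ≥0 using hδ.le
  replace hδ : 0 < δ := hδ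
  set ε : ℝ≥0 := δ / (4 * (K + 1)) with hεdef
  have hε : 0 < ε := by positivity
  have hεK : ε * (K + K) ≤ δ / 2 := by
    rw [hεdef]
    exact mul_add_self_le_half δ K
  obtain ⟨C, hC⟩ := hcompact.enorm_sub_le hlimit hε
  have hq0 : 0 < p.toReal := ENNReal.toReal_pos (zero_lt_one.trans_le hp).ne' hp'
  have hlim : Tendsto (fun n : ℕ => (C : ℝ≥0∞) * (D.toNNReal *
      ENNReal.ofReal (T / ((n : ℝ) + 1)) ^ (1 / p.toReal))) atTop (𝓝 0) := by
    have h1 : Tendsto (fun n : ℕ => T / ((n : ℝ) + 1)) atTop (𝓝 0) := by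
      simpa [div_eq_mul_inv] using tendsto_one_div_add_atTop_nhds_zero_nat.const_mul T
    have h2 := (ENNReal.tendsto_ofReal h1).ennrpow_const (1 / p.toReal)
    rw [ENNReal.ofReal_zero, ENNReal.zero_rpow_of_pos (by positivity)] at h2
    have h3 := ENNReal.Tendsto.const_mul (a := (C : ℝ≥0∞)) (ENNReal.Tendsto.const_mul
      (a := (D.toNNReal : ℝ≥0∞)) h2 (Or.inr ENNReal.coe_ne_top)) (Or.inr ENNReal.coe_ne_top)
    simpa using h3
  obtain ⟨n, hn⟩ := (hlim.eventually_le_const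
    (show (0 : ℝ≥0∞) < (δ / 2 : ℝ≥0) by exact_mod_cast half_pos hδ)).exists
  set h : ℝ≥0∞ := ENNReal.ofReal (T / ((n : ℝ) + 1)) with hh
  have hh0 : h ≠ 0 := (ENNReal.ofReal_pos.2 (by positivity)).ne'
  obtain ⟨κ, hκ, hκh⟩ := exists_equipartition hT n
  have hhp : h ^ (1 / p.toReal) ≠ 0 := by
    simp [ENNReal.rpow_eq_zero_iff, hh0, hq0.le]
  -- The gauge bound for samples; it depends on `δ` through `n`, but not on `u`.
  set R : ℝ := ((K : ℝ≥0∞) / h ^ (1 / p.toReal)).toReal with hR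
  have hstep : ∀ w : Fin (n + 1) → B, MemLp (fun t => w (κ t)) p (timeMeasure T) := fun w =>
    MemLp.of_bound (((StronglyMeasurable.of_discrete (f := w)).comp_measurable
      hκ.measurable).aestronglyMeasurable) ‖w‖ (Eventually.of_forall fun t => norm_le_pi_norm w _)
  refine ⟨(fun w => (hstep w).toLp _) '' Set.pi univ
      fun _ => closure {b | b ∈ M.carrier ∧ M.gauge b ≤ R},
    (isCompact_univ_pi fun _ => hcompact.isCompact_closure R).image
      (continuous_toLp_of_norm_sub_le hstep fun w w' t => ?_), fun u hu => ?_⟩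
  · rw [← dist_eq_norm]
    exact dist_le_pi_dist w w' _
  obtain ⟨v, huv, v', hv, hv'⟩ := hD u hu
  obtain ⟨huM, huK⟩ := hK u hu
  obtain ⟨G, hG, hGM, hle⟩ := exists_ae_enorm_sub_le hp le_rfl huM huv hv
  obtain ⟨s, hsG, hsγ, hs⟩ := exists_step_approximation hh0 hκ hκh hp hp'
    huM.2.aestronglyMeasurable hG (hle ε C hC)
  refine ⟨_, mem_image_of_mem _ (x := fun k => u (s k))
    (mem_univ_pi.2 fun k => subset_closure ⟨hGM _ (hsG k), ?_⟩), ?_⟩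
  · rw [hR, ← ENNReal.ofReal_le_iff_le_toReal (ENNReal.div_ne_top ENNReal.coe_ne_top hhp),
      ← Real.enorm_of_nonneg (M.gauge_nonneg _ (hGM _ (hsG k)))]
    exact (hsγ k).trans (by gcongr)
  · have hfin : eLpNorm (fun t => u t - u (s (κ t))) p (timeMeasure T) ≤ δ := by
      refine hs.trans ?_
      calc _ ≤ (ε : ℝ≥0∞) * (K + K) + C * (D.toNNReal * h ^ (1 / p.toReal)) := by
            gcongr
            exact eLpNorm_le_toNNReal_of_norm_le hv'
        _ ≤ (δ / 2 : ℝ≥0) + (δ / 2 : ℝ≥0) := add_le_add (by exact_mod_cast hεK) hn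
        _ = δ := by exact_mod_cast add_halves δ
    rw [dist_edist, Lp.edist_def]
    refine ENNReal.toReal_le_coe_of_le_coe ?_
    refine (eLpNorm_congr_ae ?_).trans_le hfin
    filter_upwards [(hstep fun k => u (s k)).coeFn_toLp] with t ht
    rw [Pi.sub_apply, ht]

/-- The case of the exponent `∞`. -/
theorem isCompact_closure_and_relativelyCompactInC [CompleteSpace B] [CompleteSpace Y]
    (hT : 0 < T) (hr : 1 < r) (hcompact : M.CompactlyEmbedded) (hlimit : LimitCompatible ιB ιY)
    {U : Set (Lp B ⊤ (timeMeasure T))} (hUM : M.BoundedInLpCone U)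
    (hderiv : BoundedTimeDeriv ιB ιY U r) :
    IsCompact (closure U) ∧ RelativelyCompactInC U := by
  obtain ⟨K, hK⟩ := hUM
  obtain ⟨D, hD⟩ := hderiv
  set Q : Set B := closure {b | b ∈ M.carrier ∧ M.gauge b ≤ K} with hQ
  have hQc : IsCompact Q := hcompact.isCompact_closure K
  have hsmall : ∀ η : ℝ, 0 < η → ∃ δ > 0, ∃ ε C : ℝ≥0,
      (∀ a ∈ M.carrier, ∀ b ∈ M.carrier, ∀ y : Y, ιB (a - b) = ιY y →
        ‖a - b‖ₑ ≤ ε * (‖M.gauge a‖ₑ + ‖M.gauge b‖ₑ) + C * ‖y‖ₑ) ∧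
      ∀ f : ℝ → Y, AEStronglyMeasurable f (timeMeasure T) →
        eLpNorm f r (timeMeasure T) ≤ D.toNNReal → ∀ s t : ℝ, dist s t < δ →
          ε * (K + K) + C * ∫⁻ x in uIcc s t, ‖f x‖ₑ ∂timeMeasure T ≤ ENNReal.ofReal η := by
    intro η hη
    lift η to ℝ≥0 using hη.le
    replace hη : 0 < η := hη
    have hε : 0 < η / (4 * (K + 1)) := by positivity
    have hεK : η / (4 * (K + 1)) * (K + K) ≤ η / 2 := mul_add_self_le_half η K
    obtain ⟨C, hC⟩ := hcompact.enorm_sub_le hlimit hε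
    obtain ⟨δ, hδ, h⟩ := exists_setLIntegral_uIcc_le (Y := Y) (T := T) hr C D.toNNReal
      (half_pos hη)
    refine ⟨δ, hδ, _, C, hC, fun f hf hfD s t hst => ?_⟩
    calc _ ≤ ((η / 2 : ℝ≥0) : ℝ≥0∞) + (η / 2 : ℝ≥0) :=
          add_le_add (by exact_mod_cast hεK) (h f hf hfD s t hst)
      _ = ENNReal.ofReal η := by
          rw [ENNReal.ofReal_coe_nnreal]
          exact_mod_cast add_halves η
  -- Fixed before any `u` is introduced, so the modulus `δ` is common to all of `U`.
  choose δ hδ ε C hεC hsmall using hsmall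
  have hmod : ∀ u ∈ U, ∃ G : Set ℝ, (∀ᵐ t ∂timeMeasure T, t ∈ G) ∧ (∀ t ∈ G, u t ∈ Q) ∧
      ∀ η (hη : 0 < η), ∀ s ∈ G, ∀ t ∈ G, dist s t < δ η hη → dist (u s) (u t) ≤ η := by
    intro u hu
    obtain ⟨v, huv, v', hv, hv'⟩ := hD u hu
    obtain ⟨huM, huK⟩ := hK u hu
    obtain ⟨G, hG, hGM, hle⟩ := exists_ae_enorm_sub_le le_top hr.le huM huv hv
    rw [eLpNorm_exponent_top] at huK
    refine ⟨{t | t ∈ G ∧ ‖M.gauge (u t)‖ₑ ≤ K}, ?_, ?_, ?_⟩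
    · filter_upwards [hG, enorm_ae_le_eLpNormEssSup (fun t => M.gauge (u t)) (timeMeasure T)]
        with t h1 h2
      exact ⟨h1, h2.trans huK⟩
    · rintro t ⟨ht, htK⟩
      refine subset_closure ⟨hGM t ht, (le_abs_self _).trans ?_⟩
      rw [enorm_eq_nnnorm, ENNReal.coe_le_coe] at htK
      exact_mod_cast htK
    · rintro η hη s ⟨hs, hsK⟩ t ⟨ht, htK⟩ hst
      rw [dist_comm, dist_eq_norm, ← ENNReal.ofReal_le_ofReal_iff hη.le, ofReal_norm]
      refine (hle _ _ (hεC η hη) s hs t ht).trans (le_trans ?_ (hsmall η hη v'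
        (Lp.aestronglyMeasurable v') (eLpNorm_le_toNNReal_of_norm_le hv') s t hst))
      gcongr
  set F : Set C(Icc (0 : ℝ) T, B) := {f | ∃ u ∈ U, IsContinuousRep u f} with hF
  -- Any continuous representative agrees with `u` on a dense set of good points, so the bounds pass
  -- to it by closedness.
  have hdense : ∀ f ∈ F, ∃ S : Set (Icc (0 : ℝ) T), Dense S ∧ (∀ x ∈ S, f x ∈ Q) ∧
      ∀ η (hη : 0 < η), ∀ x ∈ S, ∀ y ∈ S, dist x y < δ η hη → dist (f x) (f y) ≤ η := by
    rintro f ⟨u, hu, huf⟩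
    obtain ⟨G, hG, hGQ, hGd⟩ := hmod u hu
    refine ⟨{x | (x : ℝ) ∈ G ∧ f x = u x}, ?_, ?_, ?_⟩
    · refine (dense_of_ae_timeMeasure hT (hG.and huf)).mono ?_
      rintro x ⟨h1, h2⟩
      exact ⟨h1, h2 x.2⟩
    · rintro x ⟨hx, hx'⟩
      rw [hx']
      exact hGQ _ hx
    · rintro η hη x ⟨hx, hx'⟩ y ⟨hy, hy'⟩ hxy
      rw [hx', hy']
      exact hGd η hη _ hx _ hy hxy
  have hFc : IsCompact (closure F) := by
    refine isCompact_closure_of_modulus hQc (fun f hf x => ?_) fun η hη =>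
      ⟨δ η hη, hδ η hη, fun f hf x y hxy => ?_⟩
    · obtain ⟨S, hS, hSQ, -⟩ := hdense f hf
      exact closure_minimal (t := f ⁻¹' Q) hSQ (isClosed_closure.preimage f.continuous) (hS x)
    · obtain ⟨S, hS, -, hSd⟩ := hdense f hf
      exact dist_le_of_dense hS f.continuous (hSd η hη) hxy
  have hrep : ∀ u ∈ U, ∃ f : C(Icc (0 : ℝ) T, B), IsContinuousRep u f := fun u hu => by
    obtain ⟨G, hG, -, hGd⟩ := hmod u hu
    obtain ⟨f, hf⟩ := exists_continuous_extension hT hG fun η hη => ⟨δ η hη, hδ η hη, hGd η hη⟩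
    exact ⟨f, hG.mono fun t ht htI => hf ⟨t, htI⟩ ht⟩
  refine ⟨?_, hrep, hFc⟩
  -- Composition with `projIcc` extends `f` to the line, so that it defines a class in `L^∞(0,T;B)`.
  have hΦ : ∀ f : C(Icc (0 : ℝ) T, B),
      MemLp (fun t => f (projIcc 0 T hT.le t)) ⊤ (timeMeasure T) := fun f =>
    MemLp.of_bound (f.continuous.comp continuous_projIcc).aestronglyMeasurable ‖f‖
      (Eventually.of_forall fun t => f.norm_coe_le_norm _)
  have hΦc : Continuous fun f : C(Icc (0 : ℝ) T, B) => (hΦ f).toLp _ :=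
    continuous_toLp_of_norm_sub_le hΦ fun f g t => by
      rw [← dist_eq_norm]
      exact ContinuousMap.dist_apply_le_dist _
  refine (hFc.image hΦc).closure_of_subset fun u hu => ?_
  obtain ⟨f, hf⟩ := hrep u hu
  refine ⟨f, subset_closure ⟨u, hu, hf⟩, Lp.ext ?_⟩
  filter_upwards [(hΦ f).coeFn_toLp, hf, ae_restrict_mem measurableSet_Ioo] with t h1 h2 h3
  rw [h1, projIcc_of_mem hT.le (Ioo_subset_Icc_self h3), h2 (Ioo_subset_Icc_self h3)]

end AubinLions

theorem mainTheorem4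
    {B Y E : Type*}
    [NormedAddCommGroup B] [NormedSpace ℝ B] [CompleteSpace B]
    [NormedAddCommGroup Y] [NormedSpace ℝ Y] [CompleteSpace Y]
    [AddCommGroup E] [Module ℝ E]
    (ιB : B →ₗ[ℝ] E) (hιB : Function.Injective ιB)
    (ιY : Y →ₗ[ℝ] E) (hιY : Function.Injective ιY)
    (M : AubinLions.SeminormedCone B)
    (T : ℝ) (hT : 0 < T)
    (p r : ℝ≥0∞) [Fact (1 ≤ p)]
    (hpr : (p < ⊤ ∧ r = 1) ∨ (p = ⊤ ∧ 1 < r))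
    (hcompact : M.CompactlyEmbedded)
    (hlimit : AubinLions.LimitCompatible ιB ιY)
    (U : Set (Lp B p (AubinLions.timeMeasure T)))
    (hUY : ∀ u ∈ U, ∃ v : Lp Y p (AubinLions.timeMeasure T), AubinLions.SameFunction ιB ιY u v)
    (hUM : M.BoundedInLpCone U)
    (hderiv : AubinLions.BoundedTimeDeriv ιB ιY U r) :
    IsCompact (closure U) ∧ (p = ⊤ → AubinLions.RelativelyCompactInC U) := by
  rcases hpr with ⟨hp, rfl⟩ | ⟨rfl, hr⟩
  · exact ⟨AubinLions.isCompact_closure_of_lt_top hT hp.ne hcompact hlimit hUM hderiv,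
      fun h => absurd h hp.ne⟩
  · obtain ⟨h1, h2⟩ := AubinLions.isCompact_closure_and_relativelyCompactInC hT hr hcompact
      hlimit hUM hderiv
    exact ⟨h1, fun _ => h2⟩
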